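/- Let $q>1$, let $E$ be a real $q$-uniformly smooth Banach space (that is, $\rho_E(t)\le c\,t^q$ for all $t\ge 0$ and some $c>0$, where $\rho_E(t)=\sup\{\tfrac12(\|x+y\|+\|x-y\|)-1:\|x\|=1,\ \|y\|\le t\}$), and let $$J_q(x)=\{f\in E^*: \langle x,f\rangle=\|x\|^q,\ \|f\|=\|x\|^{q-1}\}$$ be its generalized duality mapping. Let $C_q>0$ be a constant such that $$\|x+y\|^q\le\|x\|^q+q\langle y,j\rangle+C_q\|y\|^q\qquad\text{for all }x,y\in E,\ j\in J_q(x).$$ Let $C\subseteq E$ be closed and convex, let $\lambda\in(0,1)$, and let $T:C\to C$ be a $\lambda$-strict pseudocontraction, in the sense that for all $x,y\in C$ there is $j\in J_q(x-y)$ with $$\langle Tx-Ty,j\rangle\le\|x-y\|^q-\lambda\|x-y-(Tx-Ty)\|^q$$ (for $q=2$ this is the usual definition through the normalized duality mapping). Suppose that $T$ has a fixed point. Let $u\in C$, and let $(\alpha_n)$, $(\beta_n)$, $(\gamma_n)$ $(n\ge 0)$ be real sequences with $\beta_n\in(0,1)$ and $\gamma_n\in[0,1)$ such that (i) $\alpha_n\in[0,\mu]$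 for all $n$, where $\mu=\min\{1,(q\lambda/C_q)^{1/(q-1)}\}$, and $\liminf_{n\to\infty}\alpha_n(q\lambda-C_q\alpha_n^{q-1})>0$; (ii) $\lim_{n\to\infty}\beta_n=0$ and $\sum_n\beta_n=\infty$; (iii) $\limsup_{n\to\infty}\gamma_n<1$. Let $(x_n)_{n\ge0}$ be a sequence in $C$ which satisfies, for all $n\ge 0$, the recursion $$x_{n+1}=\beta_nu+\gamma_nx_n+(1-\beta_n-\gamma_n)[\alpha_nTx_n+(1-\alpha_n)x_n],$$ or which satisfies, for all $n\ge 0$, the recursion $$x_{n+1}=\beta_nu+(1-\beta_n)[\alpha_nTx_n+(1-\alpha_n)x_n].$$ Then $(x_n)$ converges strongly to a fixed point of $T$. -/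

import Mathlib

/-- The modulus of smoothness of a real normed space:
`ρ_E(t) = sup { (‖x + y‖ + ‖x - y‖) / 2 - 1 : ‖x‖ = 1, ‖y‖ ≤ t }`.
For `t ≥ 0` the set is bounded above by `t`. -/
noncomputable def smoothnessModulus (E : Type*) [NormedAddCommGroup E] (t : ℝ) : ℝ :=
  sSup {r : ℝ | ∃ x y : E, ‖x‖ = 1 ∧ ‖y‖ ≤ t ∧ r = (‖x + y‖ + ‖x - y‖) / 2 - 1}

/-- `E` is `q`-uniformly smooth: `ρ_E(t) ≤ c t ^ q` for some constant `c > 0`. -/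
def IsQUniformlySmooth (E : Type*) [NormedAddCommGroup E] (q : ℝ) : Prop :=
  ∃ c : ℝ, 0 < c ∧ ∀ t : ℝ, 0 ≤ t → smoothnessModulus E t ≤ c * t ^ q

/-- The generalized duality mapping
`J_q(x) = { f ∈ E* : ⟨x, f⟩ = ‖x‖ ^ q, ‖f‖ = ‖x‖ ^ (q - 1) }`.
For `q = 2` it is the normalized duality mapping `J`, and `J_q(x) = ‖x‖ ^ (q - 2) J(x)`
for `x ≠ 0`. -/
def dualityMap {E : Type*} [NormedAddCommGroup E] [NormedSpace ℝ E] (q : ℝ) (x : E) :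
    Set (E →L[ℝ] ℝ) :=
  {f | f x = ‖x‖ ^ q ∧ ‖f‖ = ‖x‖ ^ (q - 1)}

/-- `C` can serve as the constant `C_q` of the `q`-uniformly smooth space `E`:
`‖x + y‖ ^ q ≤ ‖x‖ ^ q + q ⟨y, j_q(x)⟩ + C ‖y‖ ^ q` for all `x`, `y`. -/
def IsSmoothnessConstant (E : Type*) [NormedAddCommGroup E] [NormedSpace ℝ E]
    (q C : ℝ) : Prop :=
  0 < C ∧ ∀ x y : E, ∀ j ∈ dualityMap q x,
    ‖x + y‖ ^ q ≤ ‖x‖ ^ q + q * j y + C * ‖y‖ ^ q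

/-- `T : C → C` is a `lam`-strict pseudocontraction with respect to `J_q`: for all `x, y ∈ C`
there is `j ∈ J_q(x - y)` with
`⟨T x - T y, j⟩ ≤ ‖x - y‖ ^ q - lam * ‖x - y - (T x - T y)‖ ^ q`. -/
def IsStrictPseudocontraction {E : Type*} [NormedAddCommGroup E] [NormedSpace ℝ E]
    (q lam : ℝ) {C : Set E} (T : C → C) : Prop :=
  ∀ x y : C, ∃ j ∈ dualityMap q ((x : E) - (y : E)),
    j ((T x : E) - (T y : E)) ≤
      ‖(x : E) - (y : E)‖ ^ q
        - lam * ‖(x : E) - (y : E) - ((T x : E) - (T y : E))‖ ^ q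

/-! Fix one late index `N` and put `S = α_N T + (1 - α_N) I`. The smoothness inequality makes `S`
nonexpansive on `C` (`norm_average_sub_rpow_le`), and `α_N > 0` gives it the same fixed points as
`T`. The whole geometric part concerns this single map.

The limit point comes from the resolvents `z_n`, with `(n + 1)(z_n - S z_n) = u - z_n`. Let `φ(x)`
be the limit of `‖z_n - x‖` along an ultrafilter. Uniform smoothness gives reflexivity and the fixed
point property, so `φ` attains its minimum over `C` at a fixed point `p` of `S`. Comparing `φ(p)`
with `φ(p + s(u - p))` for small `s` forces `φ(p) = 0`, so the resolvents accumulate at `p`. It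
follows that `⟨u - p, j⟩` is at most `ε` for `j ∈ J_q(x - p)` whenever `x` ranges over a bounded
part of `C` and is almost fixed by `S` (`exists_forall_dualityMap_apply_le`).

For the iteration, `‖x_{n+1} - p‖^q ≤ (1 - β_n)‖x_n - p‖^q - c‖x_n - T x_n‖^q + q β_n ⟨u - p, j⟩`
with `j ∈ J_q(x_{n+1} - p)`. If the residual `‖x_n - T x_n‖` is small, the last term is at most `β_n
ε`; if not, the negative term absorbs it because `β_n → 0`. Divergence of `∑ β_n` then gives
convergence. -/

/-- Uniform smoothness of a normed space, in homogeneous form. -/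
def IsUniformlySmooth (E : Type*) [NormedAddCommGroup E] : Prop :=
  ∀ ε : ℝ, 0 < ε → ∃ t : ℝ, 0 < t ∧ t < 1 ∧
    ∀ a b : E, ‖b‖ ≤ t * ‖a‖ → ‖a + b‖ + ‖a - b‖ ≤ (2 + ε * t) * ‖a‖

theorem half_norm_add_norm_sub_le_smoothnessModulus {E : Type*} [NormedAddCommGroup E]
    {t : ℝ} {x y : E} (hx : ‖x‖ = 1) (hy : ‖y‖ ≤ t) :
    (‖x + y‖ + ‖x - y‖) / 2 - 1 ≤ smoothnessModulus E t := by
  refine le_csSup ⟨t, ?_⟩ ⟨x, y, hx, hy, rfl⟩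
  rintro r ⟨x, y, hx, hy, rfl⟩
  have h₁ := norm_add_le x y
  have h₂ := norm_sub_le x y
  linarith

/-- Since `q > 1`, `2 c t ^ (q - 1)` tends to `0` with `t`; rescaling by `‖a‖` gives the homogeneous
form. -/
theorem IsQUniformlySmooth.isUniformlySmooth {E : Type*} [NormedAddCommGroup E]
    [NormedSpace ℝ E] {q : ℝ} (hq : 1 < q) (hE : IsQUniformlySmooth E q) :
    IsUniformlySmooth E := by
  intro ε hε
  obtain ⟨c, hc, hρ⟩ := hE
  have hlim : Filter.Tendsto (fun t : ℝ => 2 * c * t ^ (q - 1)) (nhdsWithin 0 (Set.Ioi 0))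
      (nhds 0) := by
    have h := ((Real.continuousAt_rpow_const 0 (q - 1) (Or.inr (by linarith))).tendsto.const_mul
      (2 * c)).mono_left (nhdsWithin_le_nhds (s := Set.Ioi 0))
    simpa [Real.zero_rpow (by linarith : q - 1 ≠ 0)] using h
  obtain ⟨t, ht, ht01⟩ := ((hlim.eventually_lt_const hε).and
    (Ioo_mem_nhdsGT (zero_lt_one' ℝ))).exists
  refine ⟨t, ht01.1, ht01.2, fun a b hab => ?_⟩
  rcases eq_or_ne a 0 with rfl | ha
  · have hb : b = 0 := by simpa using hab
    simp [hb]
  have ha' : 0 < ‖a‖ := norm_pos_iff.2 ha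
  have key := (half_norm_add_norm_sub_le_smoothnessModulus (x := ‖a‖⁻¹ • a) (y := ‖a‖⁻¹ • b)
    (t := t) (by simp [norm_smul, ha'.ne']) (by
      rw [norm_smul, norm_inv, norm_norm, inv_mul_le_iff₀ ha']; linarith)).trans (hρ t ht01.1.le)
  rw [← smul_add, ← smul_sub, norm_smul, norm_smul, norm_inv, norm_norm, ← mul_add] at key
  have htq : t ^ q = t ^ (q - 1) * t := by
    rw [← Real.rpow_add_one ht01.1.ne']; congr 1; ring
  have h1 : ‖a‖⁻¹ * (‖a + b‖ + ‖a - b‖) ≤ 2 + ε * t := by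
    have := mul_le_mul_of_nonneg_right ht.le ht01.1.le
    rw [htq] at key
    nlinarith
  rwa [inv_mul_le_iff₀ ha', mul_comm] at h1

/-! ### Reflexivity of uniformly smooth spaces, and weak limits. -/

section Reflexive

variable {E : Type*} [NormedAddCommGroup E] [NormedSpace ℝ E]

/-- If `h ∈ E**` has distance at least `d` from `E`, then `h` is almost as large as `d` on the
unit ball of the annihilator of any point `x ∈ E`. -/
theorem exists_dual_apply_eq_zero_of_le_dist {h : StrongDual ℝ (StrongDual ℝ E)} {d r : ℝ} (hr : r < d)
    (hr0 : 0 ≤ r)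
    (hd : ∀ e : E, d ≤ ‖h - NormedSpace.inclusionInDoubleDual ℝ E e‖) (x : E) :
    ∃ f : StrongDual ℝ E, ‖f‖ ≤ 1 ∧ f x = 0 ∧ r < h f := by
  by_contra! hcon
  set ev : StrongDual ℝ (StrongDual ℝ E) := NormedSpace.inclusionInDoubleDual ℝ E x with hev
  let W : Submodule ℝ (StrongDual ℝ E) := LinearMap.ker ev.toLinearMap
  have hW : ∀ f : W, (f : StrongDual ℝ E) x = 0 := fun f => f.2
  have hle : ∀ f : W, h f ≤ r * ‖(f : StrongDual ℝ E)‖ := by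
    intro f
    rcases eq_or_ne (f : StrongDual ℝ E) 0 with hf | hf
    · simp [hf]
    have hf' : 0 < ‖(f : StrongDual ℝ E)‖ := norm_pos_iff.2 hf
    have := hcon (‖(f : StrongDual ℝ E)‖⁻¹ • (f : StrongDual ℝ E)) (by
      rw [norm_smul, norm_inv, norm_norm]
      exact (inv_mul_cancel₀ hf'.ne').le) (by simp [hW f])
    rw [map_smul, smul_eq_mul, inv_mul_le_iff₀ hf'] at this
    linarith
  -- A Hahn–Banach extension `g` of `h` from the annihilator of `x` has norm at most `r`. As `h - g`
  -- vanishes on that annihilator, it is evaluation at a multiple of `x`, which puts `h` within `r`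
  -- of `E`.
  obtain ⟨g, hgW, hg⟩ := exists_extension_norm_eq W (h.comp W.subtypeL)
  have hgr : ‖g‖ ≤ r := by
    rw [hg]
    refine ContinuousLinearMap.opNorm_le_bound _ hr0 fun f => ?_
    rw [Real.norm_eq_abs, abs_le]
    refine ⟨?_, hle f⟩
    have := hle (-f)
    simp only [NegMemClass.coe_neg, map_neg, norm_neg] at this
    simp only [ContinuousLinearMap.comp_apply, Submodule.subtypeL_apply]
    change -(r * ‖(f : StrongDual ℝ E)‖) ≤ _
    linarith
  have hker : ∃ e : E, h - g = NormedSpace.inclusionInDoubleDual ℝ E e := by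
    by_cases hx : ∃ f₀ : StrongDual ℝ E, f₀ x ≠ 0
    · obtain ⟨f₀, hf₀⟩ := hx
      refine ⟨((h - g) f₀ / f₀ x) • x, ?_⟩
      ext f
      have hmem : f - (f x / f₀ x) • f₀ ∈ W := by
        change (f - (f x / f₀ x) • f₀) x = 0
        simp [hf₀]
      have := hgW ⟨_, hmem⟩
      simp only [ContinuousLinearMap.comp_apply, Submodule.subtypeL_apply, map_sub, map_smul,
        smul_eq_mul] at this
      simp only [sub_apply, map_smul, smul_apply,
        NormedSpace.dual_def, smul_eq_mul]
      field_simp at this ⊢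
      linarith
    · push Not at hx
      refine ⟨0, ?_⟩
      ext f
      have := hgW ⟨f, hx f⟩
      simp only [ContinuousLinearMap.comp_apply, Submodule.subtypeL_apply] at this
      simp [this]
  obtain ⟨e, he⟩ := hker
  have := hd e
  have hc : h - (h - g) = g := sub_sub_cancel h g
  rw [← he, hc] at this
  linarith

theorem IsUniformlySmooth.surjective_inclusionInDoubleDual [CompleteSpace E]
    (hE : IsUniformlySmooth E) :
    Function.Surjective (NormedSpace.inclusionInDoubleDual ℝ E) := by
  intro g
  by_contra hg
  set V : Set (StrongDual ℝ (StrongDual ℝ E)) := Set.range (NormedSpace.inclusionInDoubleDual ℝ E) with hV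
  have hVc : IsClosed V := by
    have hi : Isometry (NormedSpace.inclusionInDoubleDual ℝ E) :=
      (NormedSpace.inclusionInDoubleDualLi (E := E) ℝ).isometry
    exact hi.isClosedEmbedding.isClosed_range
  have hVn : V.Nonempty := Set.range_nonempty _
  have hd : 0 < Metric.infDist g V := (hVc.notMem_iff_infDist_pos hVn).1 hg
  set d := Metric.infDist g V with hd_def
  obtain ⟨t, ht0, ht1, hsm⟩ := hE (1 / 16) (by norm_num)
  -- Chosen so that the smoothness error `t / 16` and the norming error `4 δ = t / 16` add up to `t
  -- / 8`, that is `(t / 2) * (1 / 4)`.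
  set δ : ℝ := t / 64 with hδ
  have hδ0 : 0 < δ := by positivity
  obtain ⟨_, ⟨e, rfl⟩, he⟩ := (Metric.infDist_lt_iff hVn).1
    (show Metric.infDist g V < d * (1 + δ) by rw [← hd_def]; nlinarith)
  replace he : ‖g - NormedSpace.inclusionInDoubleDual ℝ E e‖ < d * (1 + δ) :=
    (dist_eq_norm g _).symm.trans_lt he
  set h := g - NormedSpace.inclusionInDoubleDual ℝ E e with hh
  have hdist : ∀ e' : E, d ≤ ‖h - NormedSpace.inclusionInDoubleDual ℝ E e'‖ := by
    intro e'
    have h1 := Metric.infDist_le_dist_of_mem (x := g)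
      (show NormedSpace.inclusionInDoubleDual ℝ E (e + e') ∈ V from ⟨_, rfl⟩)
    have h2 : g - NormedSpace.inclusionInDoubleDual ℝ E (e + e') =
        h - NormedSpace.inclusionInDoubleDual ℝ E e' := by
      rw [map_add, hh]
      exact (sub_sub _ _ _).symm
    exact (h1.trans_eq (dist_eq_norm g _)).trans_eq (congrArg _ h2)
  have hann := exists_dual_apply_eq_zero_of_le_dist (r := d * (1 - δ)) (by nlinarith)
    (by apply mul_nonneg hd.le; linarith) hdist
  obtain ⟨f, hf1, -, hf⟩ := hann 0
  -- Both `f` and a functional `f'` vanishing at `x` nearly norm `h`, so they are nearly normed by a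
  -- common `x₀`. Evaluating `f` at `x₀ + (t / 2) x` and `f'` at `x₀ - (t / 2) x`, smoothness at
  -- `x₀` bounds `f x`. A small norm of `f` then contradicts `h f` being close to `d`.
  have hfx : ∀ x : E, ‖x‖ ≤ 1 → f x ≤ 1 / 4 := by
    intro x hx
    obtain ⟨f', hf1', hfx', hf'⟩ := hann x
    have hsum : 2 - 4 * δ < ‖f + f'‖ := by
      have h1 : h (f + f') ≤ ‖h‖ * ‖f + f'‖ := (le_abs_self _).trans (h.le_opNorm _)
      rw [map_add] at h1
      by_contra! hcon
      have h2 : ‖h‖ * ‖f + f'‖ ≤ d * (1 + δ) * (2 - 4 * δ) :=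
        mul_le_mul he.le hcon (norm_nonneg _) (by positivity)
      nlinarith [mul_pos hd hδ0, mul_pos (mul_pos hd hδ0) hδ0]
    obtain ⟨x₀, hx₀, hlt⟩ := (f + f').exists_lt_apply_of_lt_opNorm hsum
    wlog hpos : 0 ≤ (f + f') x₀ generalizing x₀
    · exact this (-x₀) (by simpa using hx₀) (by rwa [map_neg, norm_neg])
        (by rw [map_neg]; push Not at hpos; linarith)
    rw [Real.norm_of_nonneg hpos, add_apply] at hlt
    have hb1 : ∀ (k : StrongDual ℝ E) (y : E), ‖k‖ ≤ 1 → k y ≤ ‖y‖ := fun k y hk =>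
      (le_abs_self _).trans ((k.le_opNorm y).trans (mul_le_of_le_one_left (norm_nonneg _) hk))
    have hx₀' : 1 / 2 ≤ ‖x₀‖ := by
      have := hb1 f x₀ hf1
      have := hb1 f' x₀ hf1'
      linarith
    have hs := hsm x₀ ((t / 2) • x) (by
      rw [norm_smul, Real.norm_of_nonneg (by positivity)]
      nlinarith [norm_nonneg x])
    have h1 := hb1 f (x₀ + (t / 2) • x) hf1
    have h2 := hb1 f' (x₀ - (t / 2) • x) hf1'
    simp only [map_add, map_sub, map_smul, smul_eq_mul, hfx'] at h1 h2
    have h3 : (2 + 1 / 16 * t) * ‖x₀‖ ≤ 2 + 1 / 16 * t :=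
      mul_le_of_le_one_right (by positivity) hx₀.le
    nlinarith
  have hf4 : ‖f‖ ≤ 1 / 4 := by
    refine ContinuousLinearMap.opNorm_le_of_unit_norm (by norm_num) fun x hx => ?_
    rw [Real.norm_eq_abs, abs_le]
    have := hfx (-x) (by rw [norm_neg, hx])
    rw [map_neg] at this
    exact ⟨by linarith, hfx x hx.le⟩
  have h1 : h f ≤ ‖h‖ * ‖f‖ := (le_abs_self _).trans (h.le_opNorm _)
  have h2 : ‖h‖ * ‖f‖ ≤ d * (1 + δ) * (1 / 4) :=
    mul_le_mul he.le hf4 (norm_nonneg _) (by positivity)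
  nlinarith

/-- In a reflexive space, bounded families have weak limits along ultrafilters. -/
theorem exists_weak_limit_ultrafilter
    (hE : Function.Surjective (NormedSpace.inclusionInDoubleDual ℝ E)) {ι : Type*}
    (U : Ultrafilter ι) {x : ι → E} {R : ℝ} (hx : ∀ i, ‖x i‖ ≤ R) :
    ∃ w : E, ∀ f : E →L[ℝ] ℝ, Filter.Tendsto (fun i => f (x i)) U (nhds (f w)) := by
  have hlim : ∀ f : E →L[ℝ] ℝ, ∃ r, Filter.Tendsto (fun i => f (x i)) U (nhds r) := by
    intro f
    obtain ⟨r, -, hr⟩ := (isCompact_closedBall (0 : ℝ) (‖f‖ * R)).ultrafilter_le_nhds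
      (U.map fun i => f (x i)) (Filter.le_principal_iff.2 (Filter.mem_map.2
        (Filter.univ_mem' fun i => by
          simpa using (f.le_opNorm (x i)).trans
            (mul_le_mul_of_nonneg_left (hx i) (norm_nonneg _)))))
    exact ⟨r, hr⟩
  choose L hL using hlim
  let G : (E →L[ℝ] ℝ) →ₗ[ℝ] ℝ :=
    { toFun := L
      map_add' := fun f g => tendsto_nhds_unique (hL (f + g)) ((hL f).add (hL g))
      map_smul' := fun c f => tendsto_nhds_unique (hL (c • f)) ((hL f).const_mul c) }
  have hG : ∀ f, ‖G f‖ ≤ R * ‖f‖ := fun f =>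
    le_of_tendsto (hL f).norm (Filter.Eventually.of_forall fun i =>
      ((f.le_opNorm (x i)).trans (mul_le_mul_of_nonneg_left (hx i) (norm_nonneg _))).trans_eq
        (mul_comm _ _))
  obtain ⟨w, hw⟩ := hE (G.mkContinuous R hG)
  refine ⟨w, fun f => ?_⟩
  have : f w = L f := by
    rw [← NormedSpace.dual_def ℝ E w f, hw]
    rfl
  rw [this]
  exact hL f

theorem mem_of_weak_limit {ι : Type*} {l : Filter ι} [l.NeBot] {x : ι → E} {w : E}
    (hw : ∀ f : E →L[ℝ] ℝ, Filter.Tendsto (fun i => f (x i)) l (nhds (f w)))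
    {K : Set E} (hKc : IsClosed K) (hKv : Convex ℝ K) (hx : ∀ᶠ i in l, x i ∈ K) : w ∈ K := by
  by_contra hwK
  obtain ⟨f, s, hs, hK⟩ := geometric_hahn_banach_point_closed hKv hKc hwK
  exact hs.not_ge (ge_of_tendsto (hw f) (hx.mono fun i hi => (hK _ hi).le))

end Reflexive

/-! ### The asymptotic radius of a bounded family. -/

section AsymptoticRadius

variable {E : Type*} [NormedAddCommGroup E] {ι : Type*}

/-- Along an ultrafilter all these limits exist at once, so `φ` inherits convexity and the Lipschitz
bound without passing to subsequences. -/
theorem exists_tendsto_norm_sub (U : Ultrafilter ι) {z : ι → E} {R : ℝ} (hz : ∀ i, ‖z i‖ ≤ R) :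
    ∃ φ : E → ℝ, ∀ x, Filter.Tendsto (fun i => ‖z i - x‖) U (nhds (φ x)) := by
  have h : ∀ x, ∃ r, Filter.Tendsto (fun i => ‖z i - x‖) U (nhds r) := by
    intro x
    obtain ⟨r, -, hr⟩ := (isCompact_Icc (a := (0 : ℝ)) (b := R + ‖x‖)).ultrafilter_le_nhds
      (U.map fun i => ‖z i - x‖) (Filter.le_principal_iff.2 (Filter.mem_map.2
        (Filter.univ_mem' fun i =>
          ⟨norm_nonneg _, (norm_sub_le _ _).trans (add_le_add_left (hz i) _)⟩)))
    exact ⟨r, hr⟩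
  choose φ hφ using h
  exact ⟨φ, hφ⟩

variable {l : Filter ι} [l.NeBot] {z : ι → E} {φ : E → ℝ}

theorem le_add_norm_sub_of_tendsto_norm_sub
    (hφ : ∀ x, Filter.Tendsto (fun i => ‖z i - x‖) l (nhds (φ x))) (x y : E) :
    φ x ≤ φ y + ‖y - x‖ :=
  le_of_tendsto_of_tendsto' (hφ x) ((hφ y).add_const _) fun i => by
    simpa using norm_add_le (z i - y) (y - x)

theorem continuous_of_tendsto_norm_sub
    (hφ : ∀ x, Filter.Tendsto (fun i => ‖z i - x‖) l (nhds (φ x))) : Continuous φ := by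
  refine (LipschitzWith.of_le_add fun x y => ?_).continuous
  rw [dist_comm, dist_eq_norm]
  exact le_add_norm_sub_of_tendsto_norm_sub hφ x y

theorem le_of_tendsto_norm_sub_of_approx_fixed
    (hφ : ∀ x, Filter.Tendsto (fun i => ‖z i - x‖) l (nhds (φ x))) {S : E → E} {K : Set E}
    (hS : ∀ x ∈ K, ∀ y ∈ K, ‖S x - S y‖ ≤ ‖x - y‖) (hz : ∀ i, z i ∈ K)
    (hres : Filter.Tendsto (fun i => ‖z i - S (z i)‖) l (nhds 0)) {x : E} (hx : x ∈ K) :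
    φ (S x) ≤ φ x := by
  have h := hres.add (hφ x)
  rw [zero_add] at h
  refine le_of_tendsto_of_tendsto' (hφ (S x)) h fun i => ?_
  have h1 := norm_add_le (z i - S (z i)) (S (z i) - S x)
  rw [sub_add_sub_cancel] at h1
  linarith [hS _ (hz i) _ hx]

variable [NormedSpace ℝ E]

theorem convexOn_of_tendsto_norm_sub
    (hφ : ∀ x, Filter.Tendsto (fun i => ‖z i - x‖) l (nhds (φ x))) :
    ConvexOn ℝ Set.univ φ := by
  refine ⟨convex_univ, fun x _ y _ a b ha hb hab => ?_⟩
  refine le_of_tendsto_of_tendsto' (hφ _) (((hφ x).const_mul a).add ((hφ y).const_mul b))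
    fun i => ?_
  have : z i - (a • x + b • y) = a • (z i - x) + b • (z i - y) := by
    have : z i = a • z i + b • z i := by rw [← add_smul, hab, one_smul]
    nth_rewrite 1 [this]
    module
  rw [this]
  refine (norm_add_le _ _).trans_eq ?_
  rw [norm_smul, norm_smul, Real.norm_of_nonneg ha, Real.norm_of_nonneg hb]

theorem isClosed_convex_sublevel_of_tendsto_norm_sub
    (hφ : ∀ x, Filter.Tendsto (fun i => ‖z i - x‖) l (nhds (φ x))) {K : Set E}
    (hKc : IsClosed K) (hKv : Convex ℝ K) (r : ℝ) :
    IsClosed {x ∈ K | φ x ≤ r} ∧ Convex ℝ {x ∈ K | φ x ≤ r} := by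
  refine ⟨hKc.inter (isClosed_le (continuous_of_tendsto_norm_sub hφ) continuous_const), ?_⟩
  exact ((convexOn_of_tendsto_norm_sub hφ).subset (Set.subset_univ K) hKv).convex_le r

theorem norm_sub_le_of_weak_limit
    (hφ : ∀ x, Filter.Tendsto (fun i => ‖z i - x‖) l (nhds (φ x))) {w : E}
    (hw : ∀ f : E →L[ℝ] ℝ, Filter.Tendsto (fun i => f (z i)) l (nhds (f w))) (x : E) :
    ‖w - x‖ ≤ φ x := by
  obtain ⟨g, hg, hgx⟩ := exists_dual_vector'' ℝ (w - x)
  have h : Filter.Tendsto (fun i => g (z i - x)) l (nhds (g (w - x))) := by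
    simpa using (hw g).sub_const (g x)
  rw [hgx] at h
  exact le_of_tendsto_of_tendsto' h (hφ x) fun i => (le_abs_self _).trans
    ((g.le_opNorm _).trans (mul_le_of_le_one_left (norm_nonneg _) hg))

end AsymptoticRadius

/-! ### Resolvents and the fixed point property. -/

section FixedPoint

variable {E : Type*} [NormedAddCommGroup E] [NormedSpace ℝ E]

/-- The resolvent equation of `id - S`, for a nonexpansive self-map `S` of a closed convex set. -/
theorem exists_resolvent [CompleteSpace E] {S : E → E} {K : Set E} (hKc : IsClosed K)
    (hKv : Convex ℝ K) (hmaps : Set.MapsTo S K K)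
    (hS : ∀ x ∈ K, ∀ y ∈ K, ‖S x - S y‖ ≤ ‖x - y‖) {u : E} (hu : u ∈ K) {r : ℝ} (hr : 0 < r) :
    ∃ z ∈ K, r • (z - S z) = u - z := by
  have hr1 : 0 < r + 1 := by linarith
  -- The resolvent equation is the fixed point equation of this contraction, whose ratio is `r / (r
  -- + 1)`.
  set f : E → E := fun z => (1 / (r + 1)) • u + (r / (r + 1)) • S z with hf
  have hfK : Set.MapsTo f K K := fun z hz =>
    hKv hu (hmaps hz) (by positivity) (by positivity) (by field_simp; ring)
  have hc : ContractingWith (r / (r + 1)).toNNReal (hfK.restrict f K K) := by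
    constructor
    · rw [Real.toNNReal_lt_one, div_lt_one hr1]
      linarith
    · refine LipschitzWith.of_dist_le_mul fun x y => ?_
      rw [Subtype.dist_eq, Subtype.dist_eq, Real.coe_toNNReal _ (by positivity), dist_eq_norm,
        dist_eq_norm, Set.MapsTo.val_restrict_apply, Set.MapsTo.val_restrict_apply]
      have : f x - f y = (r / (r + 1)) • (S x - S y) := by simp only [hf]; module
      rw [this, norm_smul, Real.norm_of_nonneg (by positivity)]
      exact mul_le_mul_of_nonneg_left (hS _ x.2 _ y.2) (by positivity)
  obtain ⟨z, hzK, hz, -⟩ := hc.exists_fixedPoint' hKc.isComplete hfK hu (edist_ne_top _ _)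
  refine ⟨z, hzK, ?_⟩
  have h : (r + 1) • z = u + r • S z := by
    have h1 : (1 / (r + 1)) • u + (r / (r + 1)) • S z = z := hz
    nth_rewrite 1 [← h1]
    rw [smul_add, smul_smul, smul_smul, mul_one_div_cancel hr1.ne', mul_div_cancel₀ _ hr1.ne',
      one_smul]
  rw [smul_sub, sub_eq_sub_iff_add_eq_add]
  rw [add_smul, one_smul] at h
  exact h

theorem tendsto_norm_sub_of_resolvent {S : E → E} {u : E} {z : ℕ → E} {R : ℝ}
    (hz : ∀ n, ‖z n‖ ≤ R) (hres : ∀ n : ℕ, ((n : ℝ) + 1) • (z n - S (z n)) = u - z n) :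
    Filter.Tendsto (fun n => ‖z n - S (z n)‖) Filter.atTop (nhds 0) := by
  have h := (tendsto_one_div_add_atTop_nhds_zero_nat (𝕜 := ℝ)).mul_const (‖u‖ + R)
  rw [zero_mul] at h
  refine squeeze_zero (fun _ => norm_nonneg _) (fun n => ?_) h
  have h1 := congrArg norm (hres n)
  rw [norm_smul, Real.norm_of_nonneg (by positivity)] at h1
  have h2 := norm_sub_le u (z n)
  have h3 := hz n
  rw [one_div, ← div_eq_inv_mul, le_div_iff₀ (by positivity)]
  linarith

/-- Weak compactness: points chosen in the members of the chain have a weak limit along an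
ultrafilter directed towards small sets, and each member is weakly closed. -/
theorem nonempty_sInter_of_isChain
    (hE : Function.Surjective (NormedSpace.inclusionInDoubleDual ℝ E)) {K : Set E}
    (hK : Bornology.IsBounded K) {c : Set (Set E)} (hc : IsChain (· ⊆ ·) c) (hne : c.Nonempty)
    (hcK : ∀ A ∈ c, A ⊆ K ∧ A.Nonempty ∧ IsClosed A ∧ Convex ℝ A) : (⋂₀ c).Nonempty := by
  obtain ⟨R, hR⟩ := hK.exists_norm_le
  choose y hy using fun A : c => (hcK A A.2).2.1
  have : Nonempty c := hne.to_subtype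
  have : IsCodirectedOrder c := ⟨fun A B => by
    rcases hc.total A.2 B.2 with h | h
    · exact ⟨A, le_rfl, h⟩
    · exact ⟨B, h, le_rfl⟩⟩
  let U : Ultrafilter c := Ultrafilter.of Filter.atBot
  obtain ⟨w, hw⟩ := exists_weak_limit_ultrafilter hE U
    fun A : c => hR _ ((hcK A A.2).1 (hy A))
  refine ⟨w, fun A hA => mem_of_weak_limit hw (hcK A hA).2.2.1 (hcK A hA).2.2.2 ?_⟩
  exact Ultrafilter.of_le _ ((Filter.eventually_le_atBot (⟨A, hA⟩ : c)).mono fun B hB => hB (hy B))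

/-- A nonexpansive self-map of a bounded closed convex set in a uniformly smooth Banach space has
a fixed point. -/
theorem IsUniformlySmooth.exists_fixedPoint [CompleteSpace E] (hE : IsUniformlySmooth E)
    {S : E → E} {K : Set E} (hKn : K.Nonempty) (hKc : IsClosed K) (hKv : Convex ℝ K)
    (hKb : Bornology.IsBounded K) (hmaps : Set.MapsTo S K K)
    (hS : ∀ x ∈ K, ∀ y ∈ K, ‖S x - S y‖ ≤ ‖x - y‖) : ∃ p ∈ K, S p = p := by
  have hrefl := hE.surjective_inclusionInDoubleDual
  let F : Set (Set E) :=
    {A | (A ⊆ K ∧ A.Nonempty ∧ IsClosed A ∧ Convex ℝ A) ∧ Set.MapsTo S A A}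
  obtain ⟨A, -, hA⟩ := zorn_superset_nonempty F (fun c hcF hc hne => by
    refine ⟨⋂₀ c, ⟨⟨?_, ?_, ?_, ?_⟩, ?_⟩, fun A hAc => Set.sInter_subset_of_mem hAc⟩
    · obtain ⟨A, hAc⟩ := hne
      exact (Set.sInter_subset_of_mem hAc).trans (hcF hAc).1.1
    · exact nonempty_sInter_of_isChain hrefl hKb hc hne fun A hAc => (hcF hAc).1
    · exact isClosed_sInter fun A hAc => (hcF hAc).1.2.2.1
    · exact convex_sInter fun A hAc => (hcF hAc).1.2.2.2
    · exact fun x hx A hAc => (hcF hAc).2 (hx A hAc)) K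
    ⟨⟨subset_rfl, hKn, hKc, hKv⟩, hmaps⟩
  obtain ⟨⟨hAK, ⟨u, hu⟩, hAc, hAv⟩, hAS⟩ := hA.prop
  have hSA : ∀ x ∈ A, ∀ y ∈ A, ‖S x - S y‖ ≤ ‖x - y‖ := fun x hx y hy =>
    hS x (hAK hx) y (hAK hy)
  choose y hyA hy using fun n : ℕ => exists_resolvent hAc hAv hAS hSA hu
    (show (0 : ℝ) < (n : ℝ) + 1 by positivity)
  obtain ⟨R, hR⟩ := hKb.exists_norm_le
  have hyR : ∀ n, ‖y n‖ ≤ R := fun n => hR _ (hAK (hyA n))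
  let U : Ultrafilter ℕ := Filter.hyperfilter ℕ
  have hres : Filter.Tendsto (fun n => ‖y n - S (y n)‖) U (nhds 0) :=
    (tendsto_norm_sub_of_resolvent hyR hy).mono_left Nat.hyperfilter_le_atTop
  obtain ⟨φ, hφ⟩ := exists_tendsto_norm_sub U hyR
  -- Sublevel sets of `φ` in `A` are invariant under `S`, so minimality of `A` makes `φ` constant
  -- there.
  have hle : ∀ a ∈ A, ∀ b ∈ A, φ a ≤ φ b := by
    intro a ha b hb
    obtain ⟨h1, h2⟩ := isClosed_convex_sublevel_of_tendsto_norm_sub hφ hAc hAv (φ b)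
    have hmem : {x ∈ A | φ x ≤ φ b} ∈ F :=
      ⟨⟨(Set.sep_subset _ _).trans hAK, ⟨b, hb, le_rfl⟩, h1, h2⟩, fun x hx =>
        ⟨hAS hx.1, (le_of_tendsto_norm_sub_of_approx_fixed hφ hSA hyA hres hx.1).trans hx.2⟩⟩
    exact (hA.le_of_le hmem (Set.sep_subset _ _) ha).2
  have hconst : ∀ a ∈ A, φ a = φ u := fun a ha => le_antisymm (hle a ha u hu) (hle u hu a ha)
  have hzero : φ u = 0 := by
    by_contra hne
    have hpos : 0 < φ u :=
      lt_of_le_of_ne (ge_of_tendsto' (hφ u) fun _ => norm_nonneg _) (Ne.symm hne)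
    obtain ⟨w, hw⟩ := exists_weak_limit_ultrafilter hrefl U hyR
    have hwA : w ∈ A := mem_of_weak_limit hw hAc hAv (Filter.Eventually.of_forall hyA)
    obtain ⟨t, ht0, ht1, hsm⟩ := hE (1 / 4) (by norm_num)
    -- Smoothness bounds `φ(y_m - v) + φ(y_m + v)` for `v = (t / 2)(y_m - w)`. The first point lies
    -- in `A`, so its value is `φ u`; at the second, `φ` is at least the distance `(1 + t / 2)‖y_m -
    -- w‖` to the weak limit. Letting `m` run, `‖y_m - w‖` tends to `φ u` and `1 + t / 2 > 1 + t /
    -- 4` is a contradiction.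
    have hm : ∀ᶠ m in (U : Filter ℕ), (1 + t / 2) * ‖y m - w‖ ≤ (1 + 1 / 4 * t) * φ u := by
      have hlt : ∀ᶠ m in (U : Filter ℕ), ‖y m - w‖ < 2 * φ u :=
        (hφ w).eventually_lt_const (by rw [hconst w hwA]; linarith)
      filter_upwards [hlt] with m hm
      have hn : ∀ᶠ n in (U : Filter ℕ), ‖y m - w‖ / 2 < ‖y n - y m‖ :=
        (hφ (y m)).eventually_const_lt (by rw [hconst _ (hyA m)]; linarith)
      have hmid : y m - (t / 2) • (y m - w) ∈ A := by
        have := hAv (hyA m) hwA (a := 1 - t / 2) (b := t / 2) (by linarith) (by linarith)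
          (by ring)
        convert this using 1
        module
      have hlim := le_of_tendsto_of_tendsto
        ((hφ (y m - (t / 2) • (y m - w))).add (hφ (y m + (t / 2) • (y m - w))))
        ((hφ (y m)).const_mul (2 + 1 / 4 * t)) (hn.mono fun n hn => by
          have := hsm (y n - y m) ((t / 2) • (y m - w)) (by
            rw [norm_smul, Real.norm_of_nonneg (by positivity)]
            nlinarith)
          simpa only [← sub_add, ← sub_sub] using this)
      have hlow := norm_sub_le_of_weak_limit hφ hw (y m + (t / 2) • (y m - w))
      have heq : w - (y m + (t / 2) • (y m - w)) = -((1 + t / 2) • (y m - w)) := by module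
      rw [heq, norm_neg, norm_smul, Real.norm_of_nonneg (by positivity)] at hlow
      rw [hconst _ hmid, hconst _ (hyA m)] at hlim
      linarith
    have := le_of_tendsto ((hφ w).const_mul (1 + t / 2)) hm
    rw [hconst w hwA] at this
    nlinarith
  -- With `φ = 0` on `A`, the resolvents converge to every point of `A`, hence to both `u` and `S
  -- u`.
  have hlim : ∀ a ∈ A, Filter.Tendsto y U (nhds a) := fun a ha => by
    rw [tendsto_iff_norm_sub_tendsto_zero]
    have := hφ a
    rwa [hconst a ha, hzero] at this
  exact ⟨u, hAK hu, tendsto_nhds_unique (hlim _ (hAS hu)) (hlim _ hu)⟩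

end FixedPoint

/-! ### The generalized duality mapping. -/

section Duality

theorem rpow_sub_one_mul_self {q a : ℝ} (hq : 1 < q) (ha : 0 ≤ a) : a ^ (q - 1) * a = a ^ q := by
  rw [← Real.rpow_add_one' ha (by linarith), sub_add_cancel]

/-- The tangent inequality of the convex function `b ↦ b ^ q` at `a`. -/
theorem rpow_tangent_le {q a b : ℝ} (hq : 1 < q) (ha : 0 ≤ a) (hb : 0 ≤ b) :
    q * a ^ (q - 1) * (b - a) ≤ b ^ q - a ^ q := by
  rcases ha.eq_or_lt with rfl | ha
  · simpa [Real.zero_rpow (by linarith : q - 1 ≠ 0), Real.zero_rpow (by linarith : q ≠ 0)] using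
      Real.rpow_nonneg hb q
  have h := one_add_mul_self_le_rpow_one_add (s := b / a - 1)
    (by linarith [div_nonneg hb ha.le]) hq.le
  rw [add_sub_cancel, Real.div_rpow hb ha.le, le_div_iff₀ (Real.rpow_pos_of_pos ha q)] at h
  have h1 := rpow_sub_one_mul_self hq ha.le
  have h2 : q * a ^ (q - 1) * (b - a) = q * (b / a - 1) * a ^ q := by
    rw [← h1]
    field_simp
  linarith

theorem exists_rpow_sub_one_mul_le {q K ε : ℝ} (hq : 1 < q) (hε : 0 < ε) :
    ∃ s : ℝ, 0 < s ∧ s < 1 ∧ K * s ^ (q - 1) ≤ ε := by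
  have hlim : Filter.Tendsto (fun t : ℝ => K * t ^ (q - 1)) (nhdsWithin 0 (Set.Ioi 0))
      (nhds 0) := by
    have h := ((Real.continuousAt_rpow_const 0 (q - 1) (Or.inr (by linarith))).tendsto.const_mul
      K).mono_left (nhdsWithin_le_nhds (s := Set.Ioi 0))
    simpa [Real.zero_rpow (by linarith : q - 1 ≠ 0)] using h
  obtain ⟨t, ht, ht01⟩ := ((hlim.eventually_lt_const hε).and
    (Ioo_mem_nhdsGT (zero_lt_one' ℝ))).exists
  exact ⟨t, ht01.1, ht01.2, ht.le⟩

variable {E : Type*} [NormedAddCommGroup E] [NormedSpace ℝ E] {q : ℝ} {x y : E} {j : E →L[ℝ] ℝ}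

theorem dualityMap_nonempty (hq : 1 < q) (x : E) : (dualityMap q x).Nonempty := by
  by_cases hx : ‖x‖ = 0
  · have hx' : x = 0 := norm_eq_zero.1 hx
    refine ⟨0, ?_, ?_⟩ <;>
      simp [hx', Real.zero_rpow (by linarith : q - 1 ≠ 0), Real.zero_rpow (by linarith : q ≠ 0)]
  · obtain ⟨g, hg, hgx⟩ := exists_dual_vector ℝ x hx
    refine ⟨‖x‖ ^ (q - 1) • g, ?_, ?_⟩
    · rw [smul_apply, hgx, smul_eq_mul]
      exact rpow_sub_one_mul_self hq (norm_nonneg _)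
    · rw [norm_smul, hg, mul_one, Real.norm_of_nonneg (Real.rpow_nonneg (norm_nonneg _) _)]

theorem dualityMap_apply_le (hj : j ∈ dualityMap q x) (y : E) : j y ≤ ‖x‖ ^ (q - 1) * ‖y‖ := by
  rw [← hj.2]
  exact (le_abs_self _).trans (j.le_opNorm y)

/-- The functional `q • j` is a subgradient of `‖·‖ ^ q` at `x + y`. -/
theorem norm_rpow_le_of_dualityMap_add (hq : 1 < q) (hj : j ∈ dualityMap q (x + y)) :
    ‖x + y‖ ^ q ≤ ‖x‖ ^ q + q * j y := by
  have h1 := dualityMap_apply_le hj x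
  have h2 := rpow_tangent_le hq (norm_nonneg (x + y)) (norm_nonneg x)
  have h3 := rpow_sub_one_mul_self hq (norm_nonneg (x + y))
  have h4 := hj.1
  rw [map_add] at h4
  nlinarith

end Duality

/-! ### Convergence of resolvents and the variational inequality. -/

section Resolvent

variable {E : Type*} [NormedAddCommGroup E] [NormedSpace ℝ E] {q Cq : ℝ} {C : Set E} {S : E → E}

/-- Split `u - p = r((z - p) - (S z - p)) + (z - p)`; `j` is nonnegative on the first bracket
because `S` is nonexpansive and fixes `p`. -/
theorem norm_sub_rpow_le_of_resolvent (hq : 1 < q)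
    (hS : ∀ x ∈ C, ∀ y ∈ C, ‖S x - S y‖ ≤ ‖x - y‖) {p z u : E} (hp : p ∈ C) (hSp : S p = p)
    (hz : z ∈ C) {r : ℝ} (hr : 0 < r) (hrz : r • (z - S z) = u - z) {j : E →L[ℝ] ℝ}
    (hj : j ∈ dualityMap q (z - p)) : ‖z - p‖ ^ q ≤ j (u - p) := by
  have h1 : j (S z - p) ≤ ‖z - p‖ ^ q := by
    refine (dualityMap_apply_le hj _).trans ?_
    rw [← rpow_sub_one_mul_self hq (norm_nonneg _)]
    refine mul_le_mul_of_nonneg_left ?_ (Real.rpow_nonneg (norm_nonneg _) _)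
    have := hS z hz p hp
    rwa [hSp] at this
  have h2 : u - p = r • ((z - p) - (S z - p)) + (z - p) := by
    rw [sub_sub_sub_cancel_right, hrz]
    abel
  rw [h2, map_add, map_smul, map_sub, hj.1, smul_eq_mul]
  nlinarith

theorem norm_sub_le_of_resolvent (hS : ∀ x ∈ C, ∀ y ∈ C, ‖S x - S y‖ ≤ ‖x - y‖) {p z u : E}
    (hp : p ∈ C) (hSp : S p = p) (hz : z ∈ C) {r : ℝ} (hr : 0 < r)
    (hrz : r • (z - S z) = u - z) : ‖z - p‖ ≤ ‖u - p‖ := by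
  have h1 := hS z hz p hp
  rw [hSp] at h1
  have h2 : (1 + r) • (z - p) = (u - p) + r • (S z - p) := by
    have : u - p = r • (z - S z) + (z - p) := by rw [hrz]; abel
    rw [this]
    module
  have h3 := congrArg norm h2
  rw [norm_smul, Real.norm_of_nonneg (by linarith)] at h3
  have h4 := norm_add_le (u - p) (r • (S z - p))
  rw [norm_smul, Real.norm_of_nonneg hr.le] at h4
  nlinarith

/-- The asymptotic radius of a bounded family attains its infimum over a closed convex set, at a
fixed point of any given nonexpansive self-map that almost fixes the family. -/
theorem IsUniformlySmooth.exists_fixedPoint_isMinOn [CompleteSpace E] (hE : IsUniformlySmooth E)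
    {ι : Type*} {U : Ultrafilter ι} {z : ι → E} {φ : E → ℝ} {R : ℝ} (hzR : ∀ i, ‖z i‖ ≤ R)
    (hφ : ∀ x, Filter.Tendsto (fun i => ‖z i - x‖) U (nhds (φ x)))
    (hCn : C.Nonempty) (hCc : IsClosed C) (hCv : Convex ℝ C) (hmaps : Set.MapsTo S C C)
    (hS : ∀ x ∈ C, ∀ y ∈ C, ‖S x - S y‖ ≤ ‖x - y‖) (hz : ∀ i, z i ∈ C)
    (hres : Filter.Tendsto (fun i => ‖z i - S (z i)‖) U (nhds 0)) :
    ∃ p ∈ C, S p = p ∧ ∀ x ∈ C, φ p ≤ φ x := by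
  have hφ0 : ∀ x, 0 ≤ φ x := fun x => ge_of_tendsto' (hφ x) fun _ => norm_nonneg _
  have hbd : ∀ x, ‖x‖ ≤ R + φ x := fun x =>
    le_of_tendsto_of_tendsto' tendsto_const_nhds ((hφ x).const_add R) fun i => by
      have := norm_sub_norm_le x (z i)
      rw [norm_sub_rev] at this
      linarith [hzR i]
  set m := sInf (φ '' C) with hm
  have hbelow : BddBelow (φ '' C) := ⟨0, by rintro _ ⟨x, -, rfl⟩; exact hφ0 x⟩
  have hmle : ∀ x ∈ C, m ≤ φ x := fun x hx => csInf_le hbelow ⟨x, hx, rfl⟩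
  have happ : ∀ k : ℕ, ∃ x ∈ C, φ x < m + 1 / ((k : ℝ) + 1) := by
    intro k
    obtain ⟨_, ⟨x, hx, rfl⟩, hlt⟩ := exists_lt_of_csInf_lt (hCn.image φ)
      (show sInf (φ '' C) < m + 1 / ((k : ℝ) + 1) from lt_add_of_pos_right _ (by positivity))
    exact ⟨x, hx, hlt⟩
  choose y hyC hy using happ
  have hyR : ∀ k, ‖y k‖ ≤ R + (m + 1) := fun k => by
    have h1 := hbd (y k)
    have h2 : 1 / ((k : ℝ) + 1) ≤ 1 := by
      rw [div_le_one (by positivity)]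
      linarith [Nat.cast_nonneg (α := ℝ) k]
    linarith [hy k]
  obtain ⟨w, hw⟩ := exists_weak_limit_ultrafilter hE.surjective_inclusionInDoubleDual
    (Filter.hyperfilter ℕ) hyR
  have hsub := isClosed_convex_sublevel_of_tendsto_norm_sub hφ hCc hCv
  have hwk : ∀ k : ℕ, w ∈ {x ∈ C | φ x ≤ m + 1 / ((k : ℝ) + 1)} := by
    intro k
    refine mem_of_weak_limit hw (hsub _).1 (hsub _).2 ?_
    filter_upwards [Nat.hyperfilter_le_atTop (Filter.eventually_ge_atTop k)] with i hi
    exact ⟨hyC i, (hy i).le.trans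
      -- The sublevel sets decrease, so all late terms of the minimizing sequence, and hence its
      -- weak limit, lie in each of them.
      (add_le_add_right (one_div_le_one_div_of_le (by positivity)
        (add_le_add_left (Nat.cast_le.2 hi) 1)) m)⟩
  have hwm : φ w ≤ m := by
    refine ge_of_tendsto' (f := fun k : ℕ => m + 1 / ((k : ℝ) + 1)) (x := Filter.atTop) ?_
      fun k => (hwk k).2
    simpa using (tendsto_one_div_add_atTop_nhds_zero_nat (𝕜 := ℝ)).const_add m
  obtain ⟨p, hp, hSp⟩ := hE.exists_fixedPoint (S := S) (K := {x ∈ C | φ x ≤ m})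
    ⟨w, (hwk 0).1, hwm⟩ (hsub m).1 (hsub m).2
    (isBounded_iff_forall_norm_le.2 ⟨R + m, fun x hx => (hbd x).trans (by linarith [hx.2])⟩)
    (fun x hx => ⟨hmaps hx.1,
      (le_of_tendsto_norm_sub_of_approx_fixed hφ hS hz hres hx.1).trans hx.2⟩)
    fun x hx y hy => hS x hx.1 y hy.1
  exact ⟨p, hp.1, hSp, fun x hx => hp.2.trans (hmle x hx)⟩

/-- The resolvents of `id - S` at `u` accumulate at a fixed point of `S`. -/
theorem IsUniformlySmooth.exists_fixedPoint_resolvent_accumulates [CompleteSpace E]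
    (hE : IsUniformlySmooth E)
    (hq : 1 < q) (hCq : IsSmoothnessConstant E q Cq) (hCc : IsClosed C) (hCv : Convex ℝ C)
    (hmaps : Set.MapsTo S C C) (hS : ∀ x ∈ C, ∀ y ∈ C, ‖S x - S y‖ ≤ ‖x - y‖)
    {p₀ u : E} (hp₀ : p₀ ∈ C) (hSp₀ : S p₀ = p₀) (hu : u ∈ C) :
    ∃ p ∈ C, S p = p ∧
      ∀ ν : ℝ, 0 < ν → ∃ r : ℝ, 0 < r ∧ ∃ z ∈ C, r • (z - S z) = u - z ∧ ‖z - p‖ < ν := by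
  have hr : ∀ n : ℕ, (0 : ℝ) < (n : ℝ) + 1 := fun n => by positivity
  choose z hzC hz using fun n : ℕ => exists_resolvent hCc hCv hmaps hS hu (hr n)
  have hzR : ∀ n, ‖z n‖ ≤ ‖u - p₀‖ + ‖p₀‖ := fun n =>
    (norm_le_norm_sub_add (z n) p₀).trans
      (add_le_add_left (norm_sub_le_of_resolvent hS hp₀ hSp₀ (hzC n) (hr n) (hz n)) _)
  let U : Ultrafilter ℕ := Filter.hyperfilter ℕ
  have hres : Filter.Tendsto (fun n => ‖z n - S (z n)‖) U (nhds 0) :=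
    (tendsto_norm_sub_of_resolvent hzR hz).mono_left Nat.hyperfilter_le_atTop
  obtain ⟨φ, hφ⟩ := exists_tendsto_norm_sub U hzR
  obtain ⟨p, hpC, hSp, hmin⟩ :=
    hE.exists_fixedPoint_isMinOn hzR hφ ⟨u, hu⟩ hCc hCv hmaps hS hzC hres
  refine ⟨p, hpC, hSp, ?_⟩
  have hφp : 0 ≤ φ p := ge_of_tendsto' (hφ p) fun _ => norm_nonneg _
  have hq0 : 0 < q := by linarith
  -- Pass to the limit in the smoothness inequality at `z n - p` in direction `-s(u - p)`, then use
  -- that `p` minimizes `φ`. Dividing by `s` leaves the factor `s ^ (q - 1)`, which can be made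
  -- small.
  have hstep : ∀ s : ℝ, 0 < s → s < 1 →
      q * φ p ^ q ≤ Cq * ‖u - p‖ ^ q * s ^ (q - 1) := by
    intro s hs0 hs1
    have hmem : p + s • (u - p) ∈ C := hCv.add_smul_sub_mem hpC hu ⟨hs0.le, hs1.le⟩
    have hpow : ∀ x, Filter.Tendsto (fun n => ‖z n - x‖ ^ q) U (nhds (φ x ^ q)) := fun x =>
      (hφ x).rpow_const (Or.inr hq0.le)
    have hlim := le_of_tendsto_of_tendsto'
      ((hpow (p + s • (u - p))).add ((hpow p).const_mul (q * s)))
      ((hpow p).add_const (Cq * (s ^ q * ‖u - p‖ ^ q))) fun n => by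
        obtain ⟨j, hj⟩ := dualityMap_nonempty hq (z n - p)
        have h1 := hCq.2 (z n - p) (-(s • (u - p))) j hj
        have h2 := norm_sub_rpow_le_of_resolvent hq hS hpC hSp (hzC n) (hr n) (hz n) hj
        rw [map_neg, map_smul, smul_eq_mul, norm_neg, norm_smul, Real.norm_of_nonneg hs0.le,
          Real.mul_rpow hs0.le (norm_nonneg _), ← sub_eq_add_neg, sub_sub] at h1
        have := mul_le_mul_of_nonneg_left h2 (mul_pos hq0 hs0).le
        linarith
    have h1 : φ p ^ q ≤ φ (p + s • (u - p)) ^ q := Real.rpow_le_rpow hφp (hmin _ hmem) hq0.le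
    rw [← rpow_sub_one_mul_self hq hs0.le] at hlim
    refine le_of_mul_le_mul_right (a := s) ?_ hs0
    linarith
  have hzero : φ p = 0 := by
    by_contra hne
    have hpos : 0 < φ p ^ q := Real.rpow_pos_of_pos (lt_of_le_of_ne hφp (Ne.symm hne)) q
    obtain ⟨s, hs0, hs1, hs⟩ := exists_rpow_sub_one_mul_le (K := Cq * ‖u - p‖ ^ q) hq
      (show 0 < q * φ p ^ q / 2 by positivity)
    have := hstep s hs0 hs1
    linarith [mul_pos hq0 hpos]
  intro ν hν
  obtain ⟨n, hn⟩ := ((hφ p).eventually_lt_const (show φ p < ν by rwa [hzero])).exists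
  exact ⟨(n : ℝ) + 1, hr n, z n, hzC n, hz n, hn⟩

/-- If `x` almost solves `S x = x`, then `‖x - ·‖` almost increases from the resolvent `z` in the
direction of `u`. -/
theorem norm_sub_resolvent_le (hS : ∀ x ∈ C, ∀ y ∈ C, ‖S x - S y‖ ≤ ‖x - y‖) {u x z : E}
    (hx : x ∈ C) (hz : z ∈ C) {r s : ℝ} (hr : 0 ≤ r) (hs : 0 ≤ s)
    (hrz : r • (z - S z) = u - z) :
    ‖x - z‖ ≤ ‖x - z - s • (u - z)‖ + r * s * ‖x - S x‖ := by
  have h1 : (1 + r * s) • (x - z) = (x - z - s • (u - z)) + (r * s) • (x - S z) := by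
    rw [← hrz]
    module
  have h2 := congrArg norm h1
  have hrs : 0 ≤ r * s := mul_nonneg hr hs
  rw [norm_smul, Real.norm_of_nonneg (by linarith)] at h2
  have h3 := norm_add_le (x - z - s • (u - z)) ((r * s) • (x - S z))
  rw [norm_smul, Real.norm_of_nonneg hrs] at h3
  have h4 : ‖x - S z‖ ≤ ‖x - S x‖ + ‖x - z‖ := by
    have := norm_add_le (x - S x) (S x - S z)
    rw [sub_add_sub_cancel] at this
    linarith [hS x hx z hz]
  nlinarith

/-- Subtracting `s(u - p)` from `x - p` hardly decreases the norm, as this holds with a resolvent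
`z` close to `p` in place of `p`. The smoothness inequality would make the norm drop if `j (u - p)`
were large. -/
theorem exists_forall_dualityMap_apply_le (hq : 1 < q) (hCq : IsSmoothnessConstant E q Cq)
    (hS : ∀ x ∈ C, ∀ y ∈ C, ‖S x - S y‖ ≤ ‖x - y‖) {p u : E}
    (hacc : ∀ ν : ℝ, 0 < ν → ∃ r : ℝ, 0 < r ∧ ∃ z ∈ C, r • (z - S z) = u - z ∧ ‖z - p‖ < ν)
    {R ε : ℝ} (hR : 0 < R) (hε : 0 < ε) :
    ∃ η : ℝ, 0 < η ∧ ∀ x ∈ C, ‖x - p‖ ≤ R → ‖x - S x‖ ≤ η →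
      ∀ j ∈ dualityMap q (x - p), j (u - p) ≤ ε := by
  have hq0 : 0 < q := by linarith
  obtain ⟨s, hs0, hs1, hs⟩ := exists_rpow_sub_one_mul_le (K := Cq * ‖u - p‖ ^ q) hq
    (show 0 < q * ε / 2 by positivity)
  set M := R ^ (q - 1) with hM
  have hMpos : 0 < M := Real.rpow_pos_of_pos hR _
  -- Replacing `z` by `p` costs `2‖z - p‖ ≤ s ε / (4 M)`; the residual term `r s η` costs as much,
  -- for a total of `s ε / (2 M)`.
  obtain ⟨r, hr, z, hz, hrz, hzp⟩ := hacc (s * ε / (8 * M)) (by positivity)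
  refine ⟨ε / (4 * r * M), by positivity, fun x hx hxR hxS j hj => ?_⟩
  have h1 := norm_sub_resolvent_le hS hx hz hr.le hs0.le hrz
  have h2 : ‖x - p‖ ≤ ‖x - z‖ + ‖z - p‖ := by
    have := norm_add_le (x - z) (z - p)
    rwa [sub_add_sub_cancel] at this
  have h3 : ‖x - z - s • (u - z)‖ ≤ ‖x - p - s • (u - p)‖ + ‖z - p‖ := by
    have heq : x - z - s • (u - z) = (x - p - s • (u - p)) - (1 - s) • (z - p) := by module
    have := norm_sub_le (x - p - s • (u - p)) ((1 - s) • (z - p))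
    rw [← heq, norm_smul, Real.norm_of_nonneg (by linarith)] at this
    nlinarith [norm_nonneg (z - p)]
  have h4 : r * s * ‖x - S x‖ ≤ s * ε / (4 * M) := by
    have := mul_le_mul_of_nonneg_left hxS (mul_pos hr hs0).le
    refine this.trans_eq ?_
    field_simp
  have h5 : ‖x - p‖ - ‖x - p - s • (u - p)‖ ≤ s * ε / (2 * M) := by
    have e1 : s * ε / (2 * M) = s * ε / (4 * M) + 2 * (s * ε / (8 * M)) := by
      field_simp
      norm_num
    linarith
  have h6 := rpow_tangent_le hq (norm_nonneg (x - p)) (norm_nonneg (x - p - s • (u - p)))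
  have h7 : ‖x - p‖ ^ (q - 1) ≤ M := Real.rpow_le_rpow (norm_nonneg _) hxR (by linarith)
  have h7' : 0 ≤ ‖x - p‖ ^ (q - 1) := Real.rpow_nonneg (norm_nonneg _) _
  have h8 : ‖x - p‖ ^ (q - 1) * (‖x - p‖ - ‖x - p - s • (u - p)‖) ≤ s * ε / 2 := by
    have e2 : s * ε / 2 = M * (s * ε / (2 * M)) := by field_simp
    rw [e2]
    exact (mul_le_mul_of_nonneg_left h5 h7').trans
      (mul_le_mul_of_nonneg_right h7 (by positivity))
  have h9 := hCq.2 (x - p) (-(s • (u - p))) j hj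
  rw [map_neg, map_smul, smul_eq_mul, norm_neg, norm_smul, Real.norm_of_nonneg hs0.le,
    Real.mul_rpow hs0.le (norm_nonneg _), ← sub_eq_add_neg,
    ← rpow_sub_one_mul_self hq hs0.le] at h9
  refine le_of_mul_le_mul_left (a := q * s) ?_ (by positivity)
  have h10 := mul_le_mul_of_nonneg_left hs hs0.le
  have h11 := mul_le_mul_of_nonneg_left h8 hq0.le
  linarith

end Resolvent

/-! ### A numerical recursion. -/

theorem tendsto_zero_of_eventually_le_convex_comb {s β : ℕ → ℝ} (hs : ∀ n, 0 ≤ s n)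
    (hβ : ∀ n, β n ∈ Set.Ioo (0 : ℝ) 1)
    (hβsum : Filter.Tendsto (fun N => ∑ n ∈ Finset.range N, β n) Filter.atTop Filter.atTop)
    (h : ∀ ε : ℝ, 0 < ε → ∀ᶠ n in Filter.atTop, s (n + 1) ≤ (1 - β n) * s n + β n * ε) :
    Filter.Tendsto s Filter.atTop (nhds 0) := by
  refine tendsto_order.2 ⟨fun a ha => Filter.Eventually.of_forall fun n => ha.trans_le (hs n),
    fun a ha => ?_⟩
  obtain ⟨N, hN⟩ := Filter.eventually_atTop.1 (h (a / 2) (by positivity))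
  set B : ℕ → ℝ := fun n => ∑ i ∈ Finset.range n, β i with hB
  -- Discrete Grönwall: the excess over `a / 2` shrinks by `1 - β n ≤ exp (-β n)` at each step.
  have hbound : ∀ n, N ≤ n → s n - a / 2 ≤ s N * Real.exp (B N - B n) := by
    intro n hn
    induction n, hn using Nat.le_induction with
    | base => simp; linarith
    | succ n hn ih =>
      have h1 := hN n hn
      have h2 : 1 - β n ≤ Real.exp (-β n) := by linarith [Real.add_one_le_exp (-β n)]
      have h3 : B N - B (n + 1) = (B N - B n) + -β n := by
        simp only [hB, Finset.sum_range_succ]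
        ring
      rw [h3, Real.exp_add, ← mul_assoc]
      calc s (n + 1) - a / 2 ≤ (1 - β n) * (s n - a / 2) := by linarith
        _ ≤ (1 - β n) * (s N * Real.exp (B N - B n)) :=
            mul_le_mul_of_nonneg_left ih (by linarith [(hβ n).2])
        _ ≤ s N * Real.exp (B N - B n) * Real.exp (-β n) := by
            rw [mul_comm]
            exact mul_le_mul_of_nonneg_left h2 (mul_nonneg (hs N) (Real.exp_pos _).le)
  have hlim : Filter.Tendsto (fun n => s N * Real.exp (B N - B n)) Filter.atTop (nhds 0) := by
    have h1 : Filter.Tendsto (fun n => B N - B n) Filter.atTop Filter.atBot := by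
      simpa [sub_eq_add_neg] using Filter.tendsto_atBot_add_const_left _ (B N)
        (Filter.tendsto_neg_atTop_atBot.comp hβsum)
    simpa using (Real.tendsto_exp_atBot.comp h1).const_mul (s N)
  filter_upwards [hlim.eventually_lt_const (show 0 < a / 2 by positivity),
    Filter.eventually_ge_atTop N] with n hn hNn
  linarith [hbound n hNn]

/-! ### The Halpern–Mann iteration. -/

section Iteration

variable {E : Type*} [NormedAddCommGroup E] [NormedSpace ℝ E] {q Cq : ℝ} {C : Set E} {T : E → E}

/-- The smoothness inequality at `x - y` in direction `-a(x - y - (x' - y'))`. It yields both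
nonexpansiveness of `S` and the residual term of the descent estimate. -/
theorem norm_average_sub_rpow_le (hq : 1 < q) (hCq : IsSmoothnessConstant E q Cq) {lam : ℝ}
    {x y x' y' : E}
    (hT : ∃ j ∈ dualityMap q (x - y),
      j (x' - y') ≤ ‖x - y‖ ^ q - lam * ‖x - y - (x' - y')‖ ^ q) {a : ℝ} (ha : 0 ≤ a) :
    ‖(a • x' + (1 - a) • x) - (a • y' + (1 - a) • y)‖ ^ q ≤
      ‖x - y‖ ^ q - a * (q * lam - Cq * a ^ (q - 1)) * ‖x - y - (x' - y')‖ ^ q := by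
  obtain ⟨j, hj, hle⟩ := hT
  have h1 := hCq.2 (x - y) (-(a • (x - y - (x' - y')))) j hj
  have h2 : x - y + -(a • (x - y - (x' - y'))) =
      (a • x' + (1 - a) • x) - (a • y' + (1 - a) • y) := by module
  rw [h2, map_neg, map_smul, smul_eq_mul, map_sub, hj.1, norm_neg, norm_smul,
    Real.norm_of_nonneg ha, Real.mul_rpow ha (norm_nonneg _),
    ← rpow_sub_one_mul_self hq ha] at h1
  have h3 := mul_le_mul_of_nonneg_left hle (mul_nonneg (by linarith : 0 ≤ q) ha)
  linarith

/-- A convex combination with the point `0`. -/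
theorem norm_smul_add_smul_rpow_le (hq : 1 < q) {a b : ℝ} (ha : 0 ≤ a) (hb : 0 ≤ b)
    (hab : a + b ≤ 1) (x y : E) : ‖a • x + b • y‖ ^ q ≤ a * ‖x‖ ^ q + b * ‖y‖ ^ q := by
  have h1 : ‖a • x + b • y‖ ≤ a * ‖x‖ + b * ‖y‖ := by
    refine (norm_add_le _ _).trans_eq ?_
    rw [norm_smul, norm_smul, Real.norm_of_nonneg ha, Real.norm_of_nonneg hb]
  have hm : 0 ≤ a * ‖x‖ + b * ‖y‖ := by positivity
  refine (Real.rpow_le_rpow (norm_nonneg _) h1 (by linarith)).trans ?_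
  set m := a * ‖x‖ + b * ‖y‖ with hm_def
  have hx := mul_le_mul_of_nonneg_left (rpow_tangent_le hq hm (norm_nonneg x)) ha
  have hy := mul_le_mul_of_nonneg_left (rpow_tangent_le hq hm (norm_nonneg y)) hb
  have h0 := mul_le_mul_of_nonneg_left (rpow_tangent_le hq hm le_rfl)
    (by linarith : 0 ≤ 1 - a - b)
  rw [Real.zero_rpow (by linarith)] at h0
  have hsum : q * m ^ (q - 1) * (a * (‖x‖ - m) + b * (‖y‖ - m) + (1 - a - b) * (0 - m)) = 0 := by
    rw [hm_def]
    ring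
  linarith

/-- Strong convergence of the Halpern–Mann iteration, for a mapping defined on the whole space and
parameters that are eventually controlled by constants. -/
theorem exists_tendsto_fixedPoint_of_halpern [CompleteSpace E] (hq : 1 < q)
    (hE : IsUniformlySmooth E) (hCq : IsSmoothnessConstant E q Cq) (hCc : IsClosed C)
    (hCv : Convex ℝ C) {lam : ℝ} (hmaps : Set.MapsTo T C C)
    (hT : ∀ x ∈ C, ∀ y ∈ C, ∃ j ∈ dualityMap q (x - y),
      j (T x - T y) ≤ ‖x - y‖ ^ q - lam * ‖x - y - (T x - T y)‖ ^ q)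
    (hfix : ∃ p ∈ C, T p = p) {α β γ : ℕ → ℝ} {δ κ : ℝ} (hδ : 0 < δ) (hκ : 0 < κ)
    (hα : ∀ n, α n ∈ Set.Icc (0 : ℝ) 1)
    (hαδ : ∀ᶠ n in Filter.atTop, δ ≤ α n * (q * lam - Cq * α n ^ (q - 1)))
    (hβ : ∀ n, β n ∈ Set.Ioo (0 : ℝ) 1) (hβlim : Filter.Tendsto β Filter.atTop (nhds 0))
    (hβsum : Filter.Tendsto (fun N => ∑ n ∈ Finset.range N, β n) Filter.atTop Filter.atTop)
    (hγ : ∀ n, 0 ≤ γ n) (hγκ : ∀ᶠ n in Filter.atTop, γ n + κ ≤ 1)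
    {u : E} (hu : u ∈ C) {x : ℕ → E} (hxC : ∀ n, x n ∈ C)
    (hx : ∀ n, x (n + 1) = β n • u + γ n • x n
      + (1 - β n - γ n) • (α n • T (x n) + (1 - α n) • x n)) :
    ∃ p ∈ C, T p = p ∧ Filter.Tendsto x Filter.atTop (nhds p) := by
  have hq0 : 0 < q := by linarith
  obtain ⟨N, hN⟩ := Filter.eventually_atTop.1 ((hαδ.and hγκ).and
    (hβlim.eventually_lt_const (show 0 < κ / 2 by positivity)))
  have hαN := (hN N le_rfl).1.1
  have hαN0 : 0 < α N := by
    refine lt_of_le_of_ne (hα N).1 fun h => ?_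
    rw [← h, zero_mul] at hαN
    linarith
  set S : E → E := fun y => α N • T y + (1 - α N) • y with hSdef
  have hSmaps : Set.MapsTo S C C := fun y hy =>
    hCv (hmaps hy) hy (hα N).1 (by linarith [(hα N).2]) (by ring)
  have hS : ∀ y ∈ C, ∀ z ∈ C, ‖S y - S z‖ ≤ ‖y - z‖ := by
    intro y hy z hz
    refine (Real.rpow_le_rpow_iff (norm_nonneg _) (norm_nonneg _) hq0).1 ?_
    refine (norm_average_sub_rpow_le hq hCq (hT y hy z hz) (hα N).1).trans (sub_le_self _ ?_)
    exact mul_nonneg (hδ.le.trans hαN) (Real.rpow_nonneg (norm_nonneg _) _)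
  have hSsub : ∀ y, y - S y = α N • (y - T y) := fun y => by
    simp only [hSdef]
    module
  obtain ⟨p₀, hp₀C, hp₀⟩ := hfix
  obtain ⟨p, hpC, hSp, hacc⟩ := hE.exists_fixedPoint_resolvent_accumulates hq hCq hCc hCv hSmaps
    hS hp₀C (sub_eq_zero.1 (by rw [hSsub, hp₀, sub_self, smul_zero])).symm hu
  have hTp : T p = p := by
    have := hSsub p
    rw [hSp, sub_self, eq_comm, smul_eq_zero, sub_eq_zero] at this
    exact (this.resolve_left hαN0.ne').symm
  refine ⟨p, hpC, hTp, ?_⟩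
  set w : ℕ → E := fun n => α n • T (x n) + (1 - α n) • x n with hw
  have hwp : ∀ n, N ≤ n → ‖w n - p‖ ^ q ≤ ‖x n - p‖ ^ q - δ * ‖x n - T (x n)‖ ^ q := by
    intro n hn
    have h1 := norm_average_sub_rpow_le hq hCq (hT (x n) (hxC n) p hpC) (hα n).1
    have h2 : x n - p - (T (x n) - T p) = x n - T (x n) := by rw [hTp]; abel
    have h3 : α n • T p + (1 - α n) • p = p := by rw [hTp]; module
    rw [h2, h3] at h1
    have := mul_le_mul_of_nonneg_right (hN n hn).1.1 (Real.rpow_nonneg (norm_nonneg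
      (x n - T (x n))) q)
    linarith
  have hwp' : ∀ n, N ≤ n → ‖w n - p‖ ≤ ‖x n - p‖ := by
    intro n hn
    refine (Real.rpow_le_rpow_iff (norm_nonneg _) (norm_nonneg _) hq0).1 ((hwp n hn).trans
      (sub_le_self _ (mul_nonneg hδ.le (Real.rpow_nonneg (norm_nonneg _) _))))
  -- From `γ n + κ ≤ 1` and `β n < κ / 2`: the weight of the averaged step stays away from `0`.
  have hθ : ∀ n, N ≤ n → κ / 2 ≤ 1 - β n - γ n := by
    intro n hn
    linarith [(hN n hn).1.2, (hN n hn).2]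
  have hxp : ∀ n, x (n + 1) - p =
      (γ n • (x n - p) + (1 - β n - γ n) • (w n - p)) + β n • (u - p) := by
    intro n
    rw [hx n, hw]
    module
  set R : ℝ := max ‖x N - p‖ ‖u - p‖ + 1 with hR
  have hR0 : 0 < R := by
    have := (norm_nonneg (u - p)).trans (le_max_right ‖x N - p‖ ‖u - p‖)
    linarith
  have huR : ‖u - p‖ ≤ R := by linarith [le_max_right ‖x N - p‖ ‖u - p‖]
  have hxR : ∀ n, N ≤ n → ‖x n - p‖ ≤ R := by
    intro n hn
    induction n, hn using Nat.le_induction with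
    | base => linarith [le_max_left ‖x N - p‖ ‖u - p‖]
    | succ n hn ih =>
      have h1 := norm_add_le (γ n • (x n - p) + (1 - β n - γ n) • (w n - p)) (β n • (u - p))
      have h2 := norm_add_le (γ n • (x n - p)) ((1 - β n - γ n) • (w n - p))
      have hθn : 0 ≤ 1 - β n - γ n := by linarith [hθ n hn]
      rw [← hxp, norm_smul, Real.norm_of_nonneg (hβ n).1.le] at h1
      rw [norm_smul, norm_smul, Real.norm_of_nonneg (hγ n), Real.norm_of_nonneg hθn] at h2
      have h3 := mul_le_mul_of_nonneg_left ih (hγ n)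
      have h4 := mul_le_mul_of_nonneg_left ((hwp' n hn).trans ih) hθn
      have h5 := mul_le_mul_of_nonneg_left huR (hβ n).1.le
      linarith
  have hdesc : ∀ n, N ≤ n → ∀ j ∈ dualityMap q (x (n + 1) - p),
      ‖x (n + 1) - p‖ ^ q ≤ (1 - β n) * ‖x n - p‖ ^ q
        - κ / 2 * δ * ‖x n - T (x n)‖ ^ q + q * (β n * j (u - p)) := by
    intro n hn j hj
    rw [hxp n] at hj ⊢
    have h1 := norm_rpow_le_of_dualityMap_add hq hj
    have hθn : 0 ≤ 1 - β n - γ n := by linarith [hθ n hn]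
    have h2 := norm_smul_add_smul_rpow_le hq (hγ n) hθn (by linarith [(hβ n).1])
      (x n - p) (w n - p)
    have h3 := mul_le_mul_of_nonneg_left (hwp n hn) hθn
    have h4 := mul_le_mul_of_nonneg_right (hθ n hn)
      (mul_nonneg hδ.le (Real.rpow_nonneg (norm_nonneg (x n - T (x n))) q))
    rw [map_smul, smul_eq_mul] at h1
    linarith
  have hconv : Filter.Tendsto (fun n => ‖x n - p‖ ^ q) Filter.atTop (nhds 0) := by
    refine tendsto_zero_of_eventually_le_convex_comb
      (fun n => Real.rpow_nonneg (norm_nonneg _) _) hβ hβsum fun ε hε => ?_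
    obtain ⟨η, hη, hVI⟩ := exists_forall_dualityMap_apply_le hq hCq hS hacc hR0
      (show 0 < ε / q by positivity)
    set k : ℝ := κ / 2 * δ * (η / 6) ^ q with hk
    have hk0 : 0 < k := by positivity
    set M : ℝ := q * (R ^ (q - 1) * R) with hM
    have hM0 : 0 ≤ M := by positivity
    filter_upwards [Filter.eventually_ge_atTop N,
      hβlim.eventually_lt_const (show 0 < η / (8 * R) by positivity),
      hβlim.eventually_lt_const (show 0 < k / (M + 1) by positivity)] with n hn hβ1 hβ2
    obtain ⟨j, hj⟩ := dualityMap_nonempty hq (x (n + 1) - p)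
    have hd := hdesc n hn j hj
    have hn1 : N ≤ n + 1 := by omega
    rw [lt_div_iff₀ (by positivity)] at hβ1 hβ2
    -- A small residual makes `x (n + 1)` almost fixed by `S`, so the variational inequality
    -- applies; a large one contributes at least `k`, which exceeds `β n * M`.
    rcases le_or_gt ‖x n - T (x n)‖ (η / 6) with hsmall | hlarge
    · have hSle : ∀ y, ‖y - S y‖ ≤ ‖y - T y‖ := fun y => by
        rw [hSsub, norm_smul, Real.norm_of_nonneg (hα N).1]
        exact mul_le_of_le_one_left (norm_nonneg _) (hα N).2
      have hstep : ‖x (n + 1) - x n‖ ≤ β n * (2 * R) + ‖x n - T (x n)‖ := by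
        have heq : x (n + 1) - x n =
            β n • (u - x n) - ((1 - β n - γ n) * α n) • (x n - T (x n)) := by
          rw [hx n]
          module
        have hθn : 0 ≤ 1 - β n - γ n := by linarith [hθ n hn]
        have hθ1 : (1 - β n - γ n) * α n ≤ 1 :=
          mul_le_one₀ (by linarith [(hβ n).1, hγ n]) (hα n).1 (hα n).2
        have h1 := norm_sub_le (β n • (u - x n)) (((1 - β n - γ n) * α n) • (x n - T (x n)))
        rw [← heq, norm_smul, norm_smul, Real.norm_of_nonneg (hβ n).1.le,
          Real.norm_of_nonneg (mul_nonneg hθn (hα n).1)] at h1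
        have h2 : ‖u - x n‖ ≤ 2 * R := by
          have := norm_sub_le (u - p) (x n - p)
          rw [sub_sub_sub_cancel_right] at this
          linarith [hxR n hn]
        have h3 := mul_le_mul_of_nonneg_left h2 (hβ n).1.le
        have h4 := mul_le_mul_of_nonneg_right hθ1 (norm_nonneg (x n - T (x n)))
        linarith
      -- The bound is `2‖x (n + 1) - x n‖ + ‖x n - S (x n)‖ ≤ 4 R β n + 3 (η / 6)`, and `8 R β n <
      -- η`.
      have hres : ‖x (n + 1) - S (x (n + 1))‖ ≤ η := by
        have h1 := norm_add₃_le (a := x (n + 1) - x n) (b := x n - S (x n))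
          (c := S (x n) - S (x (n + 1)))
        rw [sub_add_sub_cancel, sub_add_sub_cancel] at h1
        have h2 := hS (x n) (hxC n) (x (n + 1)) (hxC (n + 1))
        rw [norm_sub_rev (x n)] at h2
        linarith [hSle (x n)]
      have hj1 := hVI (x (n + 1)) (hxC (n + 1)) (hxR (n + 1) hn1) hres j hj
      rw [le_div_iff₀ hq0] at hj1
      have h1 := mul_le_mul_of_nonneg_left hj1 (hβ n).1.le
      have h2 : 0 ≤ κ / 2 * δ * ‖x n - T (x n)‖ ^ q := by positivity
      linarith
    · have h1 : k ≤ κ / 2 * δ * ‖x n - T (x n)‖ ^ q :=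
        mul_le_mul_of_nonneg_left (Real.rpow_le_rpow (by positivity) hlarge.le hq0.le)
          (by positivity)
      have h2 : q * j (u - p) ≤ M := by
        refine mul_le_mul_of_nonneg_left ((dualityMap_apply_le hj _).trans ?_) hq0.le
        exact mul_le_mul (Real.rpow_le_rpow (norm_nonneg _) (hxR (n + 1) hn1) (by linarith)) huR
          (norm_nonneg _) (by positivity)
      have h3 := mul_le_mul_of_nonneg_left h2 (hβ n).1.le
      have h4 : 0 ≤ β n * ε := mul_nonneg (hβ n).1.le hε.le
      linarith [(hβ n).1]
  rw [tendsto_iff_norm_sub_tendsto_zero]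
  have := hconv.rpow_const (p := q⁻¹) (Or.inr (by positivity))
  rw [Real.zero_rpow (by positivity)] at this
  refine this.congr fun n => ?_
  rw [Real.rpow_rpow_inv (norm_nonneg _) hq0.ne']

end Iteration

/-! ### Reduction of the theorem to the iteration on the whole space. -/

theorem theorem3p3 {E : Type*} [NormedAddCommGroup E] [NormedSpace ℝ E] [CompleteSpace E]
    (q : ℝ) (hq : 1 < q) (hE : IsQUniformlySmooth E q)
    (Cq : ℝ) (hCq : IsSmoothnessConstant E q Cq)
    (C : Set E) (hCclosed : IsClosed C) (hCconv : Convex ℝ C)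
    (lam : ℝ) (hlam0 : 0 < lam) (hlam1 : lam < 1)
    (T : C → C) (hT : IsStrictPseudocontraction q lam T)
    (hfix : (Function.fixedPoints T).Nonempty)
    (α β γ : ℕ → ℝ)
    (hα : ∀ n, α n ∈ Set.Icc (0 : ℝ) (min 1 ((q * lam / Cq) ^ (1 / (q - 1)))))
    (hαlim : 0 < Filter.liminf
      (fun n => α n * (q * lam - Cq * α n ^ (q - 1))) Filter.atTop)
    (hβ : ∀ n, β n ∈ Set.Ioo (0 : ℝ) 1)
    (hβlim : Filter.Tendsto β Filter.atTop (nhds 0))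
    (hβsum : Filter.Tendsto (fun N => ∑ n ∈ Finset.range N, β n) Filter.atTop Filter.atTop)
    (hγ : ∀ n, γ n ∈ Set.Ico (0 : ℝ) 1)
    (hγlim : Filter.limsup γ Filter.atTop < 1)
    (u : C) (x : ℕ → C)
    (hx : (∀ n, (x (n + 1) : E) = β n • (u : E) + γ n • (x n : E)
              + (1 - β n - γ n) • (α n • (T (x n) : E) + (1 - α n) • (x n : E))) ∨
          (∀ n, (x (n + 1) : E) = β n • (u : E)
              + (1 - β n) • (α n • (T (x n) : E) + (1 - α n) • (x n : E)))) :
    ∃ z : C, T z = z ∧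
      Filter.Tendsto (fun n => (x n : E)) Filter.atTop (nhds (z : E)) := by
  classical
  have hα1 : ∀ n, α n ∈ Set.Icc (0 : ℝ) 1 := fun n =>
    ⟨(hα n).1, (hα n).2.trans (min_le_left _ _)⟩
  obtain ⟨δ, hδ, hδlim⟩ := exists_between hαlim
  have hαδ : ∀ᶠ n in Filter.atTop, δ ≤ α n * (q * lam - Cq * α n ^ (q - 1)) := by
    refine (Filter.eventually_lt_of_lt_liminf hδlim ?_).mono fun n hn => hn.le
    -- A real `liminf` yields eventual bounds only for a sequence known to be bounded below; `α n ≤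
    -- 1` supplies the bound `-Cq`.
    refine Filter.isBoundedUnder_of ⟨-Cq, fun n => ?_⟩
    have h1 : α n * α n ^ (q - 1) ≤ 1 :=
      mul_le_one₀ (hα1 n).2 (Real.rpow_nonneg (hα1 n).1 _)
        (Real.rpow_le_one (hα1 n).1 (hα1 n).2 (by linarith))
    have h2 : 0 ≤ α n * (q * lam) := mul_nonneg (hα1 n).1 (by positivity)
    have h3 := mul_le_mul_of_nonneg_left h1 hCq.1.le
    change -Cq ≤ α n * (q * lam - Cq * α n ^ (q - 1))
    linarith
  obtain ⟨g, hg, hg1⟩ := exists_between hγlim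
  have hγg : ∀ᶠ n in Filter.atTop, γ n + (1 - g) ≤ 1 := by
    refine (Filter.eventually_lt_of_limsup_lt hg ?_).mono fun n hn => by linarith
    exact Filter.isBoundedUnder_of ⟨1, fun n => (hγ n).2.le⟩
  -- The values outside `C` are irrelevant; the identity is a default.
  set T' : E → E := fun y => if hy : y ∈ C then (T ⟨y, hy⟩ : E) else y with hT'
  have hT'C : ∀ y : C, T' y = T y := fun y => by simp [hT']
  have main : ∀ γ' : ℕ → ℝ, (∀ n, 0 ≤ γ' n) → (∃ κ : ℝ, 0 < κ ∧
      ∀ᶠ n in Filter.atTop, γ' n + κ ≤ 1) →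
      (∀ n, (x (n + 1) : E) = β n • (u : E) + γ' n • (x n : E)
        + (1 - β n - γ' n) • (α n • (T (x n) : E) + (1 - α n) • (x n : E))) →
      ∃ z : C, T z = z ∧
        Filter.Tendsto (fun n => (x n : E)) Filter.atTop (nhds (z : E)) := by
    rintro γ' hγ' ⟨κ, hκ, hγκ⟩ hxγ'
    obtain ⟨p₀, hp₀⟩ := hfix
    obtain ⟨p, hpC, hp, hlim⟩ := exists_tendsto_fixedPoint_of_halpern (T := T') (lam := lam) hq
      (hE.isUniformlySmooth hq) hCq hCclosed hCconv
      (fun y hy => by rw [hT'C ⟨y, hy⟩]; exact (T _).2)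
      (fun y hy z hz => by
        rw [hT'C ⟨y, hy⟩, hT'C ⟨z, hz⟩]
        exact hT ⟨y, hy⟩ ⟨z, hz⟩)
      ⟨p₀, p₀.2, by rw [hT'C]; exact congrArg Subtype.val hp₀⟩ hδ hκ hα1 hαδ hβ hβlim hβsum hγ'
      hγκ u.2 (x := fun n => (x n : E)) (fun n => (x n).2)
      (fun n => by rw [hT'C]; exact hxγ' n)
    exact ⟨⟨p, hpC⟩, Subtype.ext ((hT'C ⟨p, hpC⟩).symm.trans hp), hlim⟩
  rcases hx with hx | hx
  · exact main γ (fun n => (hγ n).1) ⟨1 - g, by linarith, hγg⟩ hx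
  -- The second recursion is the first with `γ = 0`.
  · exact main (fun _ => 0) (fun _ => le_rfl) ⟨1, one_pos, by simp⟩ fun n => by
      simpa using hx n
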